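/- Let $\mathbb D=\{z\in\mathbb C:|z|<1\}$. For $\alpha\in\mathbb R$, a function $f$ analytic in $\mathbb D$ and $0<r<1$ put $$M_{2,\alpha}(f,r)=\frac{\int_{r\mathbb D}|f(z)|^2(1-|z|^2)^\alpha\,dA(z)}{\int_{r\mathbb D}(1-|z|^2)^\alpha\,dA(z)},$$ where $dA$ is area measure and $r\mathbb D=\{z:|z|<r\}$. A function $g$ on $(0,1)$ is called convex in $\log r$ if $t\mapsto g(e^t)$ is convex on $(-\infty,0)$. If $-3\le\alpha\le 0$, then for every $f$ analytic in $\mathbb D$ the function $r\mapsto\log M_{2,\alpha}(f,r)$ is convex in $\log r$ on $(0,1)$ (if $f\equiv0$, this function is constant, namely $\log 0$ for any convention on its value, and the claim is trivial). Moreover, the range $-3\le\alpha\le0$ is best possible: for every real $\alpha\notin[-3,0]$ there is a function $f$ analytic in $\mathbb D$ such that $r\mapsto\log M_{2,\alpha}(f,r)$ is not convex in $\log r$ on $(0,1)$. -/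

import Mathlib

open Set MeasureTheory

noncomputable section

/-- The weighted area integral mean `M_{p,α}(f, r)` of `f` over the disk `|z| < r`: the mean of
`|f|^p` with respect to the measure `(1 - |z|^2)^α dA(z)`, where `dA` is area measure
(Lebesgue measure on `ℂ`). It is meant for `0 < r < 1`, where the weight is continuous and
bounded on the disk of integration. -/
def areaMean (p α : ℝ) (f : ℂ → ℂ) (r : ℝ) : ℝ :=
  (∫ z in Metric.ball (0 : ℂ) r, ‖f z‖ ^ p * (1 - ‖z‖ ^ 2) ^ α) /
    ∫ z in Metric.ball (0 : ℂ) r, (1 - ‖z‖ ^ 2) ^ α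

/-- A function `g` of `r ∈ (0, 1)` is convex in `log r`: substituting `r = exp t`, the function
`t ↦ g (exp t)` is convex on `(-∞, 0)`. -/
def ConvexInLog (g : ℝ → ℝ) : Prop :=
  ConvexOn ℝ (Iio (0 : ℝ)) fun t => g (Real.exp t)

end

/-!
On the disk `|z| < r` the monomials are orthogonal for the weight `(1 - |z|²)^α`, so with `β = -α` and
`f = ∑ aₙ zⁿ` the area mean is `∑ |aₙ|² Mₙ(r)`, where `Mₙ(r) = Fₙ(r²) / F₀(r²)` and
`Fₙ(x) = ∫₀ˣ tⁿ (1 - t)^(-β) dt` (`tendsto_sum_monomialMean`). Sums of log-convex functions are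
log-convex by Hölder's inequality, so it suffices to treat monomials.

Write `θ = x d/dx`. The logarithmic derivative `φₙ = θ log Fₙ` satisfies the Riccati equation
`θ φₙ = φₙ (cₙ - φₙ)` with `cₙ = n + 1 + β x / (1 - x)`, and the claim for `zⁿ` is `θ φ₀ ≤ θ φₙ`
(`betaCurv_zero_le`).

* If `cⱼ (cⱼ - φⱼ) ≤ θ cⱼ`, then the Riccati equations show that `θ φₙ - θ φⱼ`, times a positive
  factor, increases wherever it is negative; starting from `0`, it never becomes negative
  (`betaCurv_le_betaCurv_add`). The hypothesis holds when `β ≤ 2 (j + 1)`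
  (`weightSlope_mul_sub_le`). For `β ≤ 2` this gives the claim with `j = 0`, and for `β ≤ 3` it
  reduces the claim to `n = 1` by taking `j = 1`.
* For `2 ≤ β ≤ 3` and `n = 1`, the quotient `s = F₁ / (x F₀)` satisfies a Riccati equation of its own,
  obtained by integration by parts. The sign of `θ φ₁ - θ φ₀` is that of an explicit polynomial `H` in
  `x` and `s`, and again `H` increases wherever it is negative (`relMean_riccati_deriv_nonneg`).

Both exceptional ranges are detected by `f(z) = z`. For `α > 0` the function `s` lies strictly below
its limit `1 / 2` at `x = 0`, while `log s` would have to be convex in `log x`. For `α < -3` the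
logarithmic derivative `φ₁ - φ₀` of `M₁` exceeds its limit `(β - 1) / (β - 2)` at `x = 1`, so it is
not increasing.
-/

noncomputable section

open Filter Topology

/-! ### Two monotonicity principles on `(0, 1)` -/

theorem nonneg_of_hasDerivAt_nonneg {g g' : ℝ → ℝ} (hc : ContinuousOn g (Ico 0 1)) (h0 : g 0 = 0)
    (hd : ∀ x ∈ Ioo (0 : ℝ) 1, HasDerivAt g (g' x) x) (hg' : ∀ x ∈ Ioo (0 : ℝ) 1, 0 ≤ g' x)
    {x : ℝ} (hx : x ∈ Ioo (0 : ℝ) 1) : 0 ≤ g x := by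
  have hmono : MonotoneOn g (Ico 0 1) := by
    refine monotoneOn_of_hasDerivWithinAt_nonneg (convex_Ico 0 1) hc (f' := g') ?_ ?_
    · intro y hy
      rw [interior_Ico] at hy
      exact (hd y hy).hasDerivWithinAt
    · intro y hy
      rw [interior_Ico] at hy
      exact hg' y hy
  have := hmono (left_mem_Ico.2 one_pos) (Ioo_subset_Ico_self hx) hx.1.le
  rwa [h0] at this

/-- A minimum principle: a function that does not start negative and increases wherever it is
negative stays nonnegative. -/
theorem nonneg_of_deriv_nonneg_of_neg {g g' η : ℝ → ℝ}
    (hd : ∀ x ∈ Ioo (0 : ℝ) 1, HasDerivAt g (g' x) x)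
    (hg' : ∀ x ∈ Ioo (0 : ℝ) 1, g x < 0 → 0 ≤ g' x)
    (hη : Tendsto η (𝓝[>] 0) (𝓝 0)) (hgη : ∀ x ∈ Ioo (0 : ℝ) 1, -η x ≤ g x)
    {x : ℝ} (hx : x ∈ Ioo (0 : ℝ) 1) : 0 ≤ g x := by
  by_contra! hneg
  -- The tilt `ε y` makes the derivative strictly positive at every point where `g` is negative.
  set ε : ℝ := -g x / 2 with hε
  have hεpos : 0 < ε := by linarith
  have hGx : g x + ε * x < 0 := by nlinarith [hx.2]
  have hev : ∀ᶠ y in 𝓝[>] (0 : ℝ), η y < -(g x + ε * x) :=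
    hη.eventually_lt_const (by linarith)
  obtain ⟨d, hd1, hdx, hd0⟩ : ∃ d, η d < -(g x + ε * x) ∧ d < x ∧ 0 < d := by
    have h2 : ∀ᶠ y in 𝓝[>] (0 : ℝ), y < x :=
      mem_nhdsWithin_of_mem_nhds (Iio_mem_nhds hx.1)
    obtain ⟨d, h⟩ := (hev.and (h2.and self_mem_nhdsWithin)).exists
    exact ⟨d, h.1, h.2.1, h.2.2⟩
  have hsub : ∀ y ∈ Icc d x, y ∈ Ioo (0 : ℝ) 1 := fun y hy =>
    ⟨hd0.trans_le hy.1, hy.2.trans_lt hx.2⟩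
  have hdG : ∀ y ∈ Icc d x, HasDerivAt (fun y => g y + ε * y) (g' y + ε) y := fun y hy => by
    exact (hd y (hsub y hy)).add (((hasDerivAt_id y).const_mul ε).congr_deriv (mul_one ε))
  obtain ⟨z, hz, hmin⟩ := isCompact_Icc.exists_isMinOn (nonempty_Icc.2 hdx.le)
    (fun y hy => (hdG y hy).continuousAt.continuousWithinAt)
  have hzx : g z + ε * z ≤ g x + ε * x := hmin (right_mem_Icc.2 hdx.le)
  have hzd : d < z := by
    rcases hz.1.lt_or_eq with h | h
    · exact h
    · have h1 := hgη d (hsub d (left_mem_Icc.2 hdx.le))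
      rw [← h] at hzx
      nlinarith
  have hgz : g z < 0 := by nlinarith [(hsub z hz).1]
  have hpos : 0 < g' z + ε := by linarith [hg' z (hsub z hz) hgz]
  have hsl := (hasDerivAt_iff_tendsto_slope.1 (hdG z hz)).eventually_const_lt hpos
  have hsl' : ∀ᶠ y in 𝓝[<] z, 0 < slope (fun y => g y + ε * y) z y :=
    hsl.filter_mono (nhdsWithin_mono _ fun y hy => ne_of_lt hy)
  have hIoo : ∀ᶠ y in 𝓝[<] z, y ∈ Ioo d z := Ioo_mem_nhdsLT hzd
  obtain ⟨y, hy1, hy2⟩ := (hsl'.and hIoo).exists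
  have hle : g z + ε * z ≤ g y + ε * y := hmin ⟨hy2.1.le, hy2.2.le.trans hz.2⟩
  rw [slope_def_field] at hy1
  have : (g y + ε * y - (g z + ε * z)) / (y - z) ≤ 0 :=
    div_nonpos_of_nonneg_of_nonpos (by linarith) (by linarith [hy2.2])
  linarith

/-! ### Incomplete beta integrals and their logarithmic derivatives -/

/-- The incomplete beta integral `∫₀ˣ tⁿ (1 - t)^(-β) dt`. Up to a constant factor it is the integral
of `|z|^(2n) (1 - |z|²)^(-β)` over the disk `|z|² < x`. -/
def betaInt (β : ℝ) (n : ℕ) (x : ℝ) : ℝ := ∫ t in (0 : ℝ)..x, t ^ n * (1 - t) ^ (-β)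

/-- The derivative of `log (betaInt β n x)` with respect to `log x`. -/
def betaSlope (β : ℝ) (n : ℕ) (x : ℝ) : ℝ := x ^ (n + 1) * (1 - x) ^ (-β) / betaInt β n x

/-- The derivative of `log (xⁿ⁺¹ (1 - x)^(-β))` with respect to `log x`. -/
def weightSlope (β : ℝ) (n : ℕ) (x : ℝ) : ℝ := n + 1 + β * x / (1 - x)

theorem continuousOn_betaIntegrand (β : ℝ) (n : ℕ) :
    ContinuousOn (fun t : ℝ => t ^ n * (1 - t) ^ (-β)) (Iio 1) := by
  refine (continuous_pow n).continuousOn.mul ?_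
  exact ContinuousOn.rpow_const (by fun_prop) fun t ht => Or.inl (sub_pos.2 ht).ne'

theorem intervalIntegrable_betaIntegrand (β : ℝ) (n : ℕ) {a b : ℝ} (ha : a < 1) (hb : b < 1) :
    IntervalIntegrable (fun t : ℝ => t ^ n * (1 - t) ^ (-β)) volume a b :=
  ((continuousOn_betaIntegrand β n).mono fun _ ht =>
    mem_Iio.2 (ht.2.trans_lt (max_lt ha hb))).intervalIntegrable

theorem hasDerivAt_betaInt (β : ℝ) (n : ℕ) {x : ℝ} (hx : x < 1) :
    HasDerivAt (betaInt β n) (x ^ n * (1 - x) ^ (-β)) x :=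
  intervalIntegral.integral_hasDerivAt_right
    (intervalIntegrable_betaIntegrand β n one_pos hx)
    ((continuousOn_betaIntegrand β n).stronglyMeasurableAtFilter isOpen_Iio x hx)
    ((continuousOn_betaIntegrand β n).continuousAt (Iio_mem_nhds hx))

@[simp] theorem betaInt_zero (β : ℝ) (n : ℕ) : betaInt β n 0 = 0 := by simp [betaInt]

theorem continuousOn_betaInt (β : ℝ) (n : ℕ) : ContinuousOn (betaInt β n) (Ico 0 1) :=
  fun _ hx => (hasDerivAt_betaInt β n hx.2).continuousAt.continuousWithinAt

theorem betaInt_pos (β : ℝ) (n : ℕ) {x : ℝ} (hx : x ∈ Ioo (0 : ℝ) 1) : 0 < betaInt β n x := by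
  refine intervalIntegral.intervalIntegral_pos_of_pos_on
    (intervalIntegrable_betaIntegrand β n one_pos hx.2) (fun t ht => ?_) hx.1
  exact mul_pos (pow_pos ht.1 n) (Real.rpow_pos_of_pos (by linarith [ht.2, hx.2]) _)

theorem betaSlope_pos (β : ℝ) (n : ℕ) {x : ℝ} (hx : x ∈ Ioo (0 : ℝ) 1) : 0 < betaSlope β n x :=
  div_pos (mul_pos (pow_pos hx.1 _) (Real.rpow_pos_of_pos (by linarith [hx.2]) _))
    (betaInt_pos β n hx)

theorem betaSlope_mul_betaInt (β : ℝ) (n : ℕ) {x : ℝ} (hx : x ∈ Ioo (0 : ℝ) 1) :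
    betaSlope β n x * betaInt β n x = x ^ (n + 1) * (1 - x) ^ (-β) :=
  div_mul_cancel₀ _ (betaInt_pos β n hx).ne'

theorem hasDerivAt_weightSlope (β : ℝ) (n : ℕ) {x : ℝ} (hx : x < 1) :
    HasDerivAt (weightSlope β n) (β / (1 - x) ^ 2) x := by
  have h1 : (1 - x) ≠ 0 := (sub_pos.2 hx).ne'
  have := (((hasDerivAt_id x).const_mul β).div ((hasDerivAt_id x).const_sub 1) h1).const_add
    ((n : ℝ) + 1)
  refine this.congr_deriv ?_
  simp only [id]
  field_simp
  ring

theorem hasDerivAt_weight (β : ℝ) (n : ℕ) {x : ℝ} (hx : x ∈ Ioo (0 : ℝ) 1) :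
    HasDerivAt (fun x : ℝ => x ^ (n + 1) * (1 - x) ^ (-β))
      (weightSlope β n x * (x ^ (n + 1) * (1 - x) ^ (-β)) / x) x := by
  have h1 : 0 < 1 - x := sub_pos.2 hx.2
  have hx0 := hx.1.ne'
  have := (hasDerivAt_pow (n + 1) x).mul
    (((hasDerivAt_id x).const_sub 1).rpow_const (p := -β) (Or.inl h1.ne'))
  refine this.congr_deriv ?_
  simp only [id, weightSlope, Real.rpow_sub_one h1.ne', Nat.add_sub_cancel]
  push_cast
  field_simp
  ring

/-- The Riccati equation of `betaSlope`. -/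
theorem hasDerivAt_betaSlope (β : ℝ) (n : ℕ) {x : ℝ} (hx : x ∈ Ioo (0 : ℝ) 1) :
    HasDerivAt (betaSlope β n) (betaSlope β n x * (weightSlope β n x - betaSlope β n x) / x) x := by
  have hF := betaInt_pos β n hx
  have hx0 := hx.1.ne'
  refine ((hasDerivAt_weight β n hx).div (hasDerivAt_betaInt β n hx.2) hF.ne').congr_deriv ?_
  simp only [betaSlope]
  field_simp
  ring

theorem continuousOn_weight (β : ℝ) (n : ℕ) :
    ContinuousOn (fun x : ℝ => x ^ (n + 1) * (1 - x) ^ (-β)) (Ico 0 1) :=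
  (continuousOn_betaIntegrand β (n + 1)).mono fun _ hx => hx.2

theorem continuousOn_weightSlope (β : ℝ) (n : ℕ) : ContinuousOn (weightSlope β n) (Ico 0 1) :=
  fun _ hx => (hasDerivAt_weightSlope β n hx.2).continuousAt.continuousWithinAt

theorem one_le_weightSlope {β : ℝ} (hβ : 0 ≤ β) (n : ℕ) {x : ℝ} (hx : x ∈ Ico (0 : ℝ) 1) :
    1 ≤ weightSlope β n x := by
  have : 0 ≤ β * x / (1 - x) := div_nonneg (mul_nonneg hβ hx.1) (by linarith [hx.2])
  have h2 : (0 : ℝ) ≤ n := n.cast_nonneg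
  simp only [weightSlope]
  linarith

theorem betaSlope_le_weightSlope {β : ℝ} (hβ : 0 ≤ β) (n : ℕ) {x : ℝ} (hx : x ∈ Ioo (0 : ℝ) 1) :
    betaSlope β n x ≤ weightSlope β n x := by
  have key : 0 ≤ weightSlope β n x * betaInt β n x - x ^ (n + 1) * (1 - x) ^ (-β) := by
    refine nonneg_of_hasDerivAt_nonneg
      (g := fun x => weightSlope β n x * betaInt β n x - x ^ (n + 1) * (1 - x) ^ (-β))
      (g' := fun x => β / (1 - x) ^ 2 * betaInt β n x)
      (((continuousOn_weightSlope β n).mul (continuousOn_betaInt β n)).sub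
        (continuousOn_weight β n)) (by simp) (fun y hy => ?_) (fun y hy => ?_) hx
    · refine (((hasDerivAt_weightSlope β n hy.2).mul (hasDerivAt_betaInt β n hy.2)).sub
        (hasDerivAt_weight β n hy)).congr_deriv ?_
      have := hy.1.ne'
      field_simp
      ring
    · exact mul_nonneg (by positivity) (betaInt_pos β n hy).le
  rw [betaSlope, div_le_iff₀ (betaInt_pos β n hx)]
  linarith

theorem one_le_betaSlope {β : ℝ} (hβ : 0 ≤ β) (n : ℕ) {x : ℝ} (hx : x ∈ Ioo (0 : ℝ) 1) :
    1 ≤ betaSlope β n x := by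
  have key : 0 ≤ x ^ (n + 1) * (1 - x) ^ (-β) - betaInt β n x := by
    refine nonneg_of_hasDerivAt_nonneg
      (g := fun x => x ^ (n + 1) * (1 - x) ^ (-β) - betaInt β n x)
      (g' := fun x => (weightSlope β n x - 1) * (x ^ n * (1 - x) ^ (-β)))
      ((continuousOn_weight β n).sub (continuousOn_betaInt β n)) (by simp)
      (fun y hy => ?_) (fun y hy => ?_) hx
    · refine ((hasDerivAt_weight β n hy).sub (hasDerivAt_betaInt β n hy.2)).congr_deriv ?_
      have := hy.1.ne'
      field_simp
      ring
    · exact mul_nonneg (by linarith [one_le_weightSlope hβ n (Ioo_subset_Ico_self hy)])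
        (mul_nonneg (pow_nonneg hy.1.le n) (Real.rpow_nonneg (by linarith [hy.2]) _))
  rw [betaSlope, le_div_iff₀ (betaInt_pos β n hx)]
  linarith

theorem betaInt_add_le (β : ℝ) (n m : ℕ) {x : ℝ} (hx : x ∈ Ioo (0 : ℝ) 1) :
    betaInt β (n + m) x ≤ x ^ m * betaInt β n x := by
  rw [betaInt, betaInt, ← intervalIntegral.integral_const_mul]
  refine intervalIntegral.integral_mono_on hx.1.le
    (intervalIntegrable_betaIntegrand β _ one_pos hx.2)
    ((intervalIntegrable_betaIntegrand β _ one_pos hx.2).const_mul _) fun t ht => ?_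
  have h1 : 0 ≤ t ^ n * (1 - t) ^ (-β) :=
    mul_nonneg (pow_nonneg ht.1 n) (Real.rpow_nonneg (by linarith [ht.2, hx.2]) _)
  have h2 : t ^ m ≤ x ^ m := pow_le_pow_left₀ ht.1 ht.2 m
  calc t ^ (n + m) * (1 - t) ^ (-β) = t ^ m * (t ^ n * (1 - t) ^ (-β)) := by ring
    _ ≤ _ := mul_le_mul_of_nonneg_right h2 h1

theorem betaSlope_le_betaSlope_add (β : ℝ) (n m : ℕ) {x : ℝ} (hx : x ∈ Ioo (0 : ℝ) 1) :
    betaSlope β n x ≤ betaSlope β (n + m) x := by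
  rw [betaSlope, betaSlope, div_le_div_iff₀ (betaInt_pos β n hx) (betaInt_pos β _ hx)]
  have h1 : 0 ≤ x ^ (n + 1) * (1 - x) ^ (-β) :=
    mul_nonneg (pow_nonneg hx.1.le _) (Real.rpow_nonneg (by linarith [hx.2]) _)
  calc _ ≤ x ^ (n + 1) * (1 - x) ^ (-β) * (x ^ m * betaInt β n x) :=
        mul_le_mul_of_nonneg_left (betaInt_add_le β n m hx) h1
    _ = _ := by ring

/-! ### Comparison of two beta integrals by a Riccati argument -/

/-- The upper bound on `weightSlope - betaSlope` on which the comparison of `betaInt β n` with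
`betaInt β (n + m)` rests. With `c = weightSlope β n` and `θ = x d/dx`, it says `c (c - φ) ≤ θ c`;
it holds because `c · θ²c ≥ 2 (θc)²`, which reduces to `β x ≤ (n + 1) (1 + x)`. -/
theorem weightSlope_mul_sub_le {β : ℝ} (hβ : 0 ≤ β) (n : ℕ) (hn : β ≤ 2 * (n + 1))
    {x : ℝ} (hx : x ∈ Ioo (0 : ℝ) 1) :
    weightSlope β n x * (weightSlope β n x - betaSlope β n x) ≤ β * x / (1 - x) ^ 2 := by
  have hcpos : ∀ y ∈ Ico (0 : ℝ) 1, 0 < weightSlope β n y := fun y hy =>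
    one_pos.trans_le (one_le_weightSlope hβ n hy)
  have hθ : ∀ y < (1 : ℝ), HasDerivAt (fun y : ℝ => β * y / (1 - y) ^ 2)
      (β * (1 + y) / (1 - y) ^ 3) y := fun y hy => by
    have h1 : 1 - y ≠ 0 := (sub_pos.2 hy).ne'
    have := ((hasDerivAt_id y).const_mul β).div (((hasDerivAt_id y).const_sub 1).pow 2)
      (pow_ne_zero 2 h1)
    refine this.congr_deriv ?_
    simp only [id, Pi.pow_apply]
    field_simp
    ring
  -- This is the claim multiplied by `betaInt β n / c ^ 2`; with that factor all
  -- terms of the derivative cancel except those with `betaInt β n` as a factor.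
  have key : 0 ≤ x ^ (n + 1) * (1 - x) ^ (-β) / weightSlope β n x -
      betaInt β n x * (1 - β * x / (1 - x) ^ 2 / weightSlope β n x ^ 2) := by
    refine nonneg_of_hasDerivAt_nonneg
      (g := fun x => x ^ (n + 1) * (1 - x) ^ (-β) / weightSlope β n x -
        betaInt β n x * (1 - β * x / (1 - x) ^ 2 / weightSlope β n x ^ 2))
      (g' := fun x => betaInt β n x * (weightSlope β n x * (β * (1 + x) / (1 - x) ^ 3) -
        2 * x * (β / (1 - x) ^ 2) ^ 2) / weightSlope β n x ^ 3) ?_ (by simp) ?_ ?_ hx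
    · refine ((continuousOn_weight β n).div (continuousOn_weightSlope β n)
        fun y hy => (hcpos y hy).ne').sub ((continuousOn_betaInt β n).mul
          (continuousOn_const.sub (ContinuousOn.div (fun y hy =>
            (hθ y hy.2).continuousAt.continuousWithinAt) ((continuousOn_weightSlope β n).pow 2)
            fun y hy => (pow_pos (hcpos y hy) 2).ne')))
    · intro y hy
      have hc := (hcpos y (Ioo_subset_Ico_self hy)).ne'
      refine (((hasDerivAt_weight β n hy).div (hasDerivAt_weightSlope β n hy.2) hc).sub
        ((hasDerivAt_betaInt β n hy.2).mul (((hθ y hy.2).div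
          ((hasDerivAt_weightSlope β n hy.2).pow 2) (pow_ne_zero 2 hc)).const_sub 1))).congr_deriv ?_
      have h1 : 1 - y ≠ 0 := (sub_pos.2 hy.2).ne'
      have h2 := hy.1.ne'
      simp only [Pi.pow_apply, Pi.div_apply]
      field_simp
      ring
    · intro y hy
      have h1 : 0 < 1 - y := sub_pos.2 hy.2
      refine div_nonneg (mul_nonneg (betaInt_pos β n hy).le ?_)
        (pow_pos (hcpos y (Ioo_subset_Ico_self hy)) 3).le
      have : weightSlope β n y * (β * (1 + y) / (1 - y) ^ 3) - 2 * y * (β / (1 - y) ^ 2) ^ 2 =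
          β * ((n + 1) * (1 + y) - β * y) / (1 - y) ^ 3 := by
        simp only [weightSlope]
        field_simp
        ring
      rw [this]
      have h3 : 0 ≤ ((n : ℝ) + 1) * (1 + y) - β * y := by
        nlinarith [hy.1, hy.2, (n.cast_nonneg : (0 : ℝ) ≤ n)]
      positivity
  have hc := hcpos x (Ioo_subset_Ico_self hx)
  have hF := betaInt_pos β n hx
  rw [← betaSlope_mul_betaInt β n hx] at key
  have h2 : betaSlope β n x * betaInt β n x / weightSlope β n x -
      betaInt β n x * (1 - β * x / (1 - x) ^ 2 / weightSlope β n x ^ 2) =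
      betaInt β n x * (β * x / (1 - x) ^ 2 -
        weightSlope β n x * (weightSlope β n x - betaSlope β n x)) / weightSlope β n x ^ 2 := by
    generalize β * x / (1 - x) ^ 2 = b
    field_simp
    ring
  rw [h2] at key
  by_contra! hlt
  refine key.not_gt (div_neg_of_neg_of_pos (mul_neg_of_pos_of_neg hF (by linarith)) (by positivity))

/-- The second derivative of `log (betaInt β n x)` with respect to `log x`. -/
def betaCurv (β : ℝ) (n : ℕ) (x : ℝ) : ℝ :=
  betaSlope β n x * (weightSlope β n x - betaSlope β n x)

theorem weightSlope_add (β : ℝ) (n m : ℕ) (x : ℝ) :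
    weightSlope β (n + m) x = weightSlope β n x + m := by
  simp only [weightSlope]
  push_cast
  ring

theorem betaCurv_le_betaCurv_add {β : ℝ} (hβ : 0 ≤ β) (n m : ℕ) (hn : β ≤ 2 * (n + 1))
    {x : ℝ} (hx : x ∈ Ioo (0 : ℝ) 1) : betaCurv β n x ≤ betaCurv β (n + m) x := by
  -- `g` is the difference of the two sides, multiplied by the factor `F / (p q)`, where
  -- `F = betaInt β (n + m)`, `p` and `q` are the two slopes; then `x g'` is `F / (p q)` times
  -- `(p - q) (θc - V (q + X))`, where `V = c - q` and `X = c + m - p`.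
  set g : ℝ → ℝ := fun x => betaInt β (n + m) x *
    ((weightSlope β (n + m) x - betaSlope β (n + m) x) / betaSlope β n x -
      (weightSlope β n x - betaSlope β n x) / betaSlope β (n + m) x) with hg
  have hgeq : ∀ y ∈ Ioo (0 : ℝ) 1, g y = betaInt β (n + m) y *
      (betaCurv β (n + m) y - betaCurv β n y) / (betaSlope β n y * betaSlope β (n + m) y) := by
    intro y hy
    have hp := (betaSlope_pos β (n + m) hy).ne'
    have hq := (betaSlope_pos β n hy).ne'
    simp only [hg, betaCurv]
    field_simp
  have key : 0 ≤ g x := by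
    refine nonneg_of_deriv_nonneg_of_neg
      (η := fun x => weightSlope β n x * betaInt β (n + m) x)
      (g' := fun x => betaInt β (n + m) x / (betaSlope β (n + m) x * betaSlope β n x) *
        ((betaSlope β (n + m) x - betaSlope β n x) *
        (β * x / (1 - x) ^ 2 - (weightSlope β n x - betaSlope β n x) *
        (betaSlope β n x + (weightSlope β (n + m) x - betaSlope β (n + m) x)))) / x) ?_ ?_ ?_ ?_ hx
    · intro y hy
      have hp := (betaSlope_pos β (n + m) hy).ne'
      have hq := (betaSlope_pos β n hy).ne'
      have h2 := hy.1.ne'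
      have h3 := hasDerivAt_betaInt β (n + m) hy.2
      have h4 : y ^ (n + m) * (1 - y) ^ (-β) =
          betaSlope β (n + m) y * betaInt β (n + m) y / y := by
        rw [betaSlope_mul_betaInt β (n + m) hy, pow_succ]
        field_simp
      rw [h4] at h3
      refine (h3.mul
        ((((hasDerivAt_weightSlope β (n + m) hy.2).sub
          (hasDerivAt_betaSlope β (n + m) hy)).div (hasDerivAt_betaSlope β n hy) hq).sub
        (((hasDerivAt_weightSlope β n hy.2).sub
          (hasDerivAt_betaSlope β n hy)).div (hasDerivAt_betaSlope β (n + m) hy) hp))).congr_deriv ?_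
      simp only [Pi.sub_apply, Pi.div_apply]
      generalize betaSlope β (n + m) y = p at *
      generalize betaSlope β n y = q at *
      rw [weightSlope_add]
      have h5 : 1 - y ≠ 0 := (sub_pos.2 hy.2).ne'
      field_simp
      ring
    · intro y hy hneg
      have hp := betaSlope_pos β (n + m) hy
      have hq := betaSlope_pos β n hy
      have hF := betaInt_pos β (n + m) hy
      have hpq := betaSlope_le_betaSlope_add β n m hy
      have hV := betaSlope_le_weightSlope hβ n hy
      have hD := weightSlope_mul_sub_le hβ n hn hy
      have hXV : weightSlope β (n + m) y - betaSlope β (n + m) y ≤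
          weightSlope β n y - betaSlope β n y := by
        rw [hgeq y hy] at hneg
        have h6 : betaCurv β (n + m) y - betaCurv β n y < 0 := by
          by_contra! h
          exact absurd hneg (not_lt.2 (by positivity))
        simp only [betaCurv] at h6
        have h7 : betaSlope β n y * (weightSlope β n y - betaSlope β n y) ≤
            betaSlope β (n + m) y * (weightSlope β n y - betaSlope β n y) :=
          mul_le_mul_of_nonneg_right hpq (sub_nonneg.2 hV)
        exact (lt_of_mul_lt_mul_left (h7.trans_lt' (by linarith)) hp.le).le
      have h8 := mul_le_mul_of_nonneg_left hXV (sub_nonneg.2 hV)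
      refine div_nonneg (mul_nonneg (by positivity) (mul_nonneg (sub_nonneg.2 hpq) ?_)) hy.1.le
      nlinarith
    · have hc : ContinuousAt (fun x => weightSlope β n x * betaInt β (n + m) x) 0 :=
        (hasDerivAt_weightSlope β n one_pos).continuousAt.mul
          (hasDerivAt_betaInt β (n + m) one_pos).continuousAt
      have := hc.tendsto
      simp only [betaInt_zero, mul_zero] at this
      exact this.mono_left nhdsWithin_le_nhds
    · intro y hy
      have hp := one_le_betaSlope hβ (n + m) hy
      have hq := betaSlope_pos β n hy
      have hF := betaInt_pos β (n + m) hy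
      have hX := betaSlope_le_weightSlope hβ (n + m) hy
      have h1 : 0 ≤ (weightSlope β (n + m) y - betaSlope β (n + m) y) / betaSlope β n y :=
        div_nonneg (by linarith) hq.le
      have hV := betaSlope_le_weightSlope hβ n hy
      have h2 : (weightSlope β n y - betaSlope β n y) / betaSlope β (n + m) y ≤
          weightSlope β n y - betaSlope β n y := div_le_self (by linarith) hp
      simp only [hg]
      nlinarith
  rw [hgeq x hx] at key
  have hp := betaSlope_pos β (n + m) hx
  have hq := betaSlope_pos β n hx
  have hF := betaInt_pos β (n + m) hx
  by_contra! h
  exact key.not_gt (div_neg_of_neg_of_pos (mul_neg_of_pos_of_neg hF (by linarith)) (by positivity))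

/-! ### The first moment -/

/-- The mean of `t / x` over `[0, x]` with respect to the weight `(1 - t)^(-β)`. -/
def relMean (β x : ℝ) : ℝ := betaInt β 1 x / (x * betaInt β 0 x)

/-- Integration by parts: both sides are primitives of `(1 + (β - 2) x) (1 - x)^(-β)`. -/
theorem betaInt_zero_add_betaInt_one (β : ℝ) {x : ℝ} (hx : x ∈ Ioo (0 : ℝ) 1) :
    betaInt β 0 x + (β - 2) * betaInt β 1 x = x * (1 - x) * (1 - x) ^ (-β) := by
  have hcont : ContinuousOn (fun x : ℝ => x ^ (0 + 1) * (1 - x) ^ (-β) * (1 - x) -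
      (betaInt β 0 x + (β - 2) * betaInt β 1 x)) (Ico 0 1) :=
    ((continuousOn_weight β 0).mul (by fun_prop)).sub
      ((continuousOn_betaInt β 0).add (continuousOn_const.mul (continuousOn_betaInt β 1)))
  have hder : ∀ y ∈ Ioo (0 : ℝ) 1, HasDerivAt (fun x : ℝ => x ^ (0 + 1) * (1 - x) ^ (-β) * (1 - x) -
      (betaInt β 0 x + (β - 2) * betaInt β 1 x)) 0 y := by
    intro y hy
    refine (((hasDerivAt_weight β 0 hy).mul ((hasDerivAt_id y).const_sub 1)).sub
      ((hasDerivAt_betaInt β 0 hy.2).add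
        ((hasDerivAt_betaInt β 1 hy.2).const_mul (β - 2)))).congr_deriv ?_
    have h1 : 1 - y ≠ 0 := (sub_pos.2 hy.2).ne'
    have h2 := hy.1.ne'
    simp only [weightSlope, id]
    push_cast
    field_simp
    ring
  have h1 := nonneg_of_hasDerivAt_nonneg hcont (by simp) hder (fun _ _ => le_rfl) hx
  have h2 := nonneg_of_hasDerivAt_nonneg hcont.neg (by simp) (fun y hy => (hder y hy).neg)
    (fun _ _ => by simp) hx
  simp only [Pi.neg_apply, zero_add, pow_one] at h1 h2
  linarith

theorem relMean_pos (β : ℝ) {x : ℝ} (hx : x ∈ Ioo (0 : ℝ) 1) : 0 < relMean β x :=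
  div_pos (betaInt_pos β 1 hx) (mul_pos hx.1 (betaInt_pos β 0 hx))

theorem relMean_le_one (β : ℝ) {x : ℝ} (hx : x ∈ Ioo (0 : ℝ) 1) : relMean β x ≤ 1 := by
  rw [relMean, div_le_one (mul_pos hx.1 (betaInt_pos β 0 hx))]
  simpa using betaInt_add_le β 0 1 hx

/-- An increasing weight pushes the mean to the right of the midpoint. -/
theorem half_le_relMean {β : ℝ} (hβ : 0 ≤ β) {x : ℝ} (hx : x ∈ Ioo (0 : ℝ) 1) :
    1 / 2 ≤ relMean β x := by
  have key : 0 ≤ betaInt β 1 x - x * betaInt β 0 x / 2 := by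
    refine nonneg_of_hasDerivAt_nonneg
      (g := fun x => betaInt β 1 x - x * betaInt β 0 x / 2)
      (g' := fun x => (x * (1 - x) ^ (-β) - betaInt β 0 x) / 2)
      ((continuousOn_betaInt β 1).sub ((continuousOn_id.mul (continuousOn_betaInt β 0)).div_const 2))
      (by simp) (fun y hy => ?_) (fun y hy => ?_) hx
    · refine ((hasDerivAt_betaInt β 1 hy.2).sub
        (((hasDerivAt_id y).mul (hasDerivAt_betaInt β 0 hy.2)).div_const 2)).congr_deriv ?_
      simp only [id]
      ring
    · have h1 := one_le_betaSlope hβ 0 hy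
      rw [betaSlope, le_div_iff₀ (betaInt_pos β 0 hy), zero_add, pow_one] at h1
      linarith
  rw [relMean, le_div_iff₀ (mul_pos hx.1 (betaInt_pos β 0 hx))]
  linarith

/-- The Riccati equation of `relMean`. -/
theorem hasDerivAt_relMean (β : ℝ) {x : ℝ} (hx : x ∈ Ioo (0 : ℝ) 1) :
    HasDerivAt (relMean β) ((1 - 2 * relMean β x +
      x * relMean β x * (1 + (β - 2) * (1 - relMean β x))) / (x * (1 - x))) x := by
  have hF0 := (betaInt_pos β 0 hx).ne'
  have h1 : 1 - x ≠ 0 := (sub_pos.2 hx.2).ne'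
  have h2 := hx.1.ne'
  refine ((hasDerivAt_betaInt β 1 hx.2).div ((hasDerivAt_id x).mul (hasDerivAt_betaInt β 0 hx.2))
    (mul_ne_zero h2 hF0)).congr_deriv ?_
  have hw : (1 - x) ^ (-β) = (betaInt β 0 x + (β - 2) * betaInt β 1 x) / (x * (1 - x)) := by
    rw [betaInt_zero_add_betaInt_one β hx]
    field_simp
  simp only [id, relMean, hw, Pi.mul_apply]
  field_simp
  ring

theorem betaSlope_zero_eq (β : ℝ) {x : ℝ} (hx : x ∈ Ioo (0 : ℝ) 1) :
    betaSlope β 0 x = (1 + (β - 2) * x * relMean β x) / (1 - x) := by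
  have hF0 := (betaInt_pos β 0 hx).ne'
  have h1 : 1 - x ≠ 0 := (sub_pos.2 hx.2).ne'
  have h2 := hx.1.ne'
  have hw : (1 - x) ^ (-β) = (betaInt β 0 x + (β - 2) * betaInt β 1 x) / (x * (1 - x)) := by
    rw [betaInt_zero_add_betaInt_one β hx]
    field_simp
  simp only [betaSlope, relMean, hw]
  field_simp
  ring

theorem betaSlope_one_eq (β : ℝ) {x : ℝ} (hx : x ∈ Ioo (0 : ℝ) 1) :
    betaSlope β 1 x = betaSlope β 0 x / relMean β x := by
  have hF0 := (betaInt_pos β 0 hx).ne'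
  have hF1 := (betaInt_pos β 1 hx).ne'
  have h2 := hx.1.ne'
  simp only [betaSlope, relMean]
  field_simp
  ring

theorem betaCurv_one_sub_zero (β : ℝ) {x : ℝ} (hx : x ∈ Ioo (0 : ℝ) 1) :
    betaCurv β 1 x - betaCurv β 0 x = (1 + (β - 2) * x * relMean β x) *
      (2 * relMean β x - 1 - x * relMean β x ^ 2 * (1 + (β - 2) * (1 - relMean β x))) /
      ((1 - x) ^ 2 * relMean β x ^ 2) := by
  have hs := (relMean_pos β hx).ne'
  have h1 : 1 - x ≠ 0 := (sub_pos.2 hx.2).ne'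
  simp only [betaCurv, betaSlope_one_eq β hx, betaSlope_zero_eq β hx, weightSlope]
  push_cast
  field_simp
  ring

/-- The algebraic core of the comparison for `2 ≤ β ≤ 3`. With `δ = β - 2` and `s = relMean β x`, the
quantity assumed negative is the function `H` that carries the sign of
`betaCurv β 1 x - betaCurv β 0 x`, and the one shown nonnegative is `x (1 - x) H'`, evaluated with the
Riccati equation of `relMean`. -/
theorem relMean_riccati_deriv_nonneg {δ s x : ℝ} (hδ : 0 ≤ δ) (hδ1 : δ ≤ 1) (hs : 1 / 2 ≤ s) (hs1 : s ≤ 1)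
    (hx1 : x ≤ 1) (hH : 2 * s - 1 - x * s ^ 2 * (1 + δ * (1 - s)) < 0) :
    0 ≤ (1 - 2 * s + x * s * (1 + δ * (1 - s))) *
        (2 - 2 * x * s * (1 + δ * (1 - s)) + δ * x * s ^ 2) -
      x * (1 - x) * s ^ 2 * (1 + δ * (1 - s)) := by
  obtain ⟨e, rfl⟩ : ∃ e, s = 1 - e := ⟨1 - s, by ring⟩
  set H := 2 * (1 - e) - 1 - x * (1 - e) ^ 2 * (1 + δ * (1 - (1 - e))) with hHdef
  have he0 : 0 ≤ e := by linarith
  have he : e ≤ 1 / 2 := by linarith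
  -- `κ` and `M` are read off from eliminating `x` in favour of `H` in the quantity to be bounded;
  -- the assumption `δ ≤ 1` is what makes `κ` nonnegative.
  set κ := 1 - δ + 3 * δ * e with hκ
  set M := 1 - 2 * e + 3 * e ^ 2 + δ * (1 - 3 * e + e ^ 2 + 5 * e ^ 3) with hM
  have hid : (1 - e) ^ 2 * (1 + δ * e) * ((1 - 2 * (1 - e) + x * (1 - e) * (1 + δ * (1 - (1 - e)))) *
        (2 - 2 * x * (1 - e) * (1 + δ * (1 - (1 - e))) + δ * x * (1 - e) ^ 2) -
      x * (1 - x) * (1 - e) ^ 2 * (1 + δ * (1 - (1 - e)))) =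
      κ * ((1 - 2 * e) * e ^ 2) + (-H) * (M - κ * (-H)) := by
    rw [hM, hκ, hHdef]
    ring
  have hκ0 : 0 ≤ κ := by nlinarith [mul_nonneg hδ he0]
  have hη : -H ≤ e ^ 2 + e * (1 - e) ^ 2 := by
    have h1 : x * ((1 - e) ^ 2 * (1 + δ * e)) ≤ 1 * ((1 - e) ^ 2 * (1 + δ * e)) :=
      mul_le_mul_of_nonneg_right hx1 (by positivity)
    have h2 : δ * (e * (1 - e) ^ 2) ≤ 1 * (e * (1 - e) ^ 2) :=
      mul_le_mul_of_nonneg_right hδ1 (by positivity)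
    rw [hHdef]
    nlinarith
  have hMκ : κ * (-H) ≤ M := by
    have h1 : κ * (-H) ≤ κ * (e ^ 2 + e * (1 - e) ^ 2) := mul_le_mul_of_nonneg_left hη hκ0
    have h3 : 0 ≤ 1 - 3 * e + e ^ 2 + 5 * e ^ 3 := by
      nlinarith [mul_nonneg he0 (sq_nonneg (e - 2 / 5)), sq_nonneg (e - 2 / 5)]
    have h4 : 1 - 2 * e + 3 * e ^ 2 ≤ M := by
      rw [hM]
      nlinarith [mul_nonneg hδ h3]
    refine h1.trans (le_trans ?_ h4)
    rcases le_total e (1 / 3) with h | h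
    · have : κ ≤ 1 := by nlinarith
      have h5 : κ * (e ^ 2 + e * (1 - e) ^ 2) ≤ 1 * (e ^ 2 + e * (1 - e) ^ 2) :=
        mul_le_mul_of_nonneg_right this (by positivity)
      nlinarith [pow_nonneg he0 3, sq_nonneg (e - 1 / 3), mul_nonneg he0 (sq_nonneg (e - 1 / 3))]
    · have : κ ≤ 3 * e := by nlinarith
      have h5 : κ * (e ^ 2 + e * (1 - e) ^ 2) ≤ 3 * e * (e ^ 2 + e * (1 - e) ^ 2) :=
        mul_le_mul_of_nonneg_right this (by positivity)
      nlinarith [pow_nonneg he0 3, mul_nonneg (pow_nonneg he0 3) (by linarith : 0 ≤ 1 - e)]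
  have hpos : 0 < (1 - e) ^ 2 * (1 + δ * e) := by
    have : 0 < 1 - e := by linarith
    positivity
  refine le_of_mul_le_mul_left ?_ hpos
  rw [hid, mul_zero]
  have h5 : 0 ≤ 1 - 2 * e := by linarith
  exact add_nonneg (by positivity) (mul_nonneg (by linarith) (by linarith))

theorem betaCurv_zero_le_betaCurv_one {β : ℝ} (hβ : 2 ≤ β) (hβ3 : β ≤ 3) {x : ℝ}
    (hx : x ∈ Ioo (0 : ℝ) 1) : betaCurv β 0 x ≤ betaCurv β 1 x := by
  have key : 0 ≤ 2 * relMean β x - 1 -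
      x * relMean β x ^ 2 * (1 + (β - 2) * (1 - relMean β x)) := by
    refine nonneg_of_deriv_nonneg_of_neg (η := fun x => 2 * x)
      (g := fun x => 2 * relMean β x - 1 -
        x * relMean β x ^ 2 * (1 + (β - 2) * (1 - relMean β x)))
      (g' := fun x => ((1 - 2 * relMean β x +
        x * relMean β x * (1 + (β - 2) * (1 - relMean β x))) *
        (2 - 2 * x * relMean β x * (1 + (β - 2) * (1 - relMean β x)) +
          (β - 2) * x * relMean β x ^ 2) -
        x * (1 - x) * relMean β x ^ 2 * (1 + (β - 2) * (1 - relMean β x))) / (x * (1 - x)))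
      ?_ ?_ ?_ ?_ hx
    · intro y hy
      have h1 : 1 - y ≠ 0 := (sub_pos.2 hy.2).ne'
      have h2 := hy.1.ne'
      have hs := hasDerivAt_relMean β hy
      refine (((hs.const_mul 2).sub_const 1).sub (((hasDerivAt_id y).mul (hs.pow 2)).mul
        (((hs.const_sub 1).const_mul (β - 2)).const_add 1))).congr_deriv ?_
      simp only [id, Pi.mul_apply, Pi.pow_apply]
      field_simp
      ring
    · intro y hy hneg
      refine div_nonneg (relMean_riccati_deriv_nonneg (by linarith) (by linarith) (half_le_relMean (by linarith) hy)
        (relMean_le_one β hy) hy.2.le hneg) (mul_nonneg hy.1.le (by linarith [hy.2]))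
    · have : Tendsto (fun x : ℝ => 2 * x) (𝓝 0) (𝓝 (2 * 0)) := tendsto_id.const_mul 2
      rw [mul_zero] at this
      exact this.mono_left nhdsWithin_le_nhds
    · intro y hy
      have h1 := half_le_relMean (by linarith : 0 ≤ β) hy
      have h2 := relMean_le_one β hy
      have h3 : relMean β y ^ 2 * (1 + (β - 2) * (1 - relMean β y)) ≤ 1 * 2 := by
        refine mul_le_mul (by nlinarith) (by nlinarith) ?_ zero_le_one
        nlinarith
      have h4 := mul_le_mul_of_nonneg_left h3 hy.1.le
      nlinarith
  rw [← sub_nonneg, betaCurv_one_sub_zero β hx]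
  refine div_nonneg (mul_nonneg ?_ key) (by positivity)
  have := mul_nonneg (mul_nonneg (by linarith : 0 ≤ β - 2) hx.1.le) (relMean_pos β hx).le
  linarith

theorem betaCurv_zero_le {β : ℝ} (hβ : 0 ≤ β) (hβ3 : β ≤ 3) (n : ℕ) {x : ℝ}
    (hx : x ∈ Ioo (0 : ℝ) 1) : betaCurv β 0 x ≤ betaCurv β n x := by
  rcases le_total β 2 with h2 | h2
  · have := betaCurv_le_betaCurv_add hβ 0 n (by push_cast; linarith) hx
    rwa [zero_add] at this
  · obtain _ | n := n
    · exact le_rfl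
    · have := betaCurv_le_betaCurv_add hβ 1 n (by push_cast; linarith) hx
      rw [add_comm 1 n] at this
      exact (betaCurv_zero_le_betaCurv_one h2 hβ3 hx).trans this

/-! ### Logarithmic convexity for monomials -/

/-- The mean of `|z|^(2n)` over the disk `|z| < r` with respect to the weight `(1 - |z|²)^(-β)`. -/
def monomialMean (β : ℝ) (n : ℕ) (r : ℝ) : ℝ := betaInt β n (r ^ 2) / betaInt β 0 (r ^ 2)

theorem exp_sq_mem_Ioo {t : ℝ} (ht : t < 0) : Real.exp t ^ 2 ∈ Ioo (0 : ℝ) 1 :=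
  ⟨by positivity, pow_lt_one₀ (Real.exp_pos t).le (Real.exp_lt_one_iff.2 ht) two_ne_zero⟩

theorem hasDerivAt_exp_sq (t : ℝ) :
    HasDerivAt (fun t => Real.exp t ^ 2) (2 * Real.exp t ^ 2) t := by
  refine ((Real.hasDerivAt_exp t).pow 2).congr_deriv ?_
  push_cast
  ring

theorem monomialMean_pos (β : ℝ) (n : ℕ) {t : ℝ} (ht : t < 0) :
    0 < monomialMean β n (Real.exp t) :=
  div_pos (betaInt_pos β n (exp_sq_mem_Ioo ht)) (betaInt_pos β 0 (exp_sq_mem_Ioo ht))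

theorem hasDerivAt_log_monomialMean (β : ℝ) (n : ℕ) {t : ℝ} (ht : t < 0) :
    HasDerivAt (fun t => Real.log (monomialMean β n (Real.exp t)))
      (2 * (betaSlope β n (Real.exp t ^ 2) - betaSlope β 0 (Real.exp t ^ 2))) t := by
  have hx := exp_sq_mem_Ioo ht
  have hn := betaInt_pos β n hx
  have h0 := betaInt_pos β 0 hx
  have hd : ∀ k, HasDerivAt (fun t => betaInt β k (Real.exp t ^ 2))
      ((Real.exp t ^ 2) ^ k * (1 - Real.exp t ^ 2) ^ (-β) * (2 * Real.exp t ^ 2)) t := fun k =>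
    HasDerivAt.comp (h₂ := betaInt β k) t (hasDerivAt_betaInt β k hx.2) (hasDerivAt_exp_sq t)
  refine (((hd n).div (hd 0) h0.ne').log (div_pos hn h0).ne').congr_deriv ?_
  simp only [betaSlope, Pi.div_apply]
  generalize Real.exp t ^ 2 = x at *
  field_simp
  ring

theorem convexInLog_log_monomialMean {β : ℝ} (hβ : 0 ≤ β) (hβ3 : β ≤ 3) (n : ℕ) :
    ConvexInLog fun r => Real.log (monomialMean β n r) := by
  refine convexOn_of_hasDerivWithinAt2_nonneg (convex_Iio 0)
    (f' := fun t => 2 * (betaSlope β n (Real.exp t ^ 2) - betaSlope β 0 (Real.exp t ^ 2)))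
    (f'' := fun t => 4 * (betaCurv β n (Real.exp t ^ 2) - betaCurv β 0 (Real.exp t ^ 2)))
    (fun t ht => (hasDerivAt_log_monomialMean β n ht).continuousAt.continuousWithinAt) ?_ ?_ ?_
  · intro t ht
    rw [interior_Iio] at ht
    exact (hasDerivAt_log_monomialMean β n ht).hasDerivWithinAt
  · intro t ht
    rw [interior_Iio] at ht
    have hx := exp_sq_mem_Ioo ht
    have hd : ∀ k, HasDerivAt (fun t => betaSlope β k (Real.exp t ^ 2))
        (2 * betaCurv β k (Real.exp t ^ 2)) t := fun k => by
      refine ((hasDerivAt_betaSlope β k hx).comp t (hasDerivAt_exp_sq t)).congr_deriv ?_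
      have := hx.1.ne'
      rw [betaCurv]
      field_simp
    refine (((hd n).sub (hd 0)).const_mul 2).hasDerivWithinAt.congr_deriv ?_
    ring
  · intro t ht
    rw [interior_Iio] at ht
    linarith [betaCurv_zero_le hβ hβ3 n (exp_sq_mem_Ioo ht)]

/-! ### Expansion of the area mean in Taylor coefficients -/

theorem setIntegral_ball_norm (g : ℝ → ℝ) {r : ℝ} (hr : 0 ≤ r) :
    ∫ z in Metric.ball (0 : ℂ) r, g ‖z‖ = 2 * Real.pi * ∫ s in (0 : ℝ)..r, s * g s := by
  have h1 : (Metric.ball (0 : ℂ) r).indicator (fun z => g ‖z‖) =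
      fun z => (Iio r).indicator g ‖z‖ := by
    ext z
    by_cases h : ‖z‖ < r <;> simp [indicator, h]
  have h2 : ∀ y : ℝ, y ^ (2 - 1) • (Iio r).indicator g y =
      (Iio r).indicator (fun s => s * g s) y := by
    intro y
    by_cases h : y < r <;> simp [indicator, h]
  rw [← integral_indicator measurableSet_ball, h1, integral_fun_norm_addHaar,
    Complex.finrank_real_complex]
  simp_rw [h2]
  rw [setIntegral_indicator measurableSet_Iio, Ioi_inter_Iio,
    intervalIntegral.integral_of_le hr, integral_Ioc_eq_integral_Ioo]
  simp [measureReal_def, Complex.volume_ball]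
  ring

theorem setIntegral_ball_monomial (β : ℝ) (n : ℕ) {r : ℝ} (hr : 0 ≤ r) (hr1 : r < 1) :
    ∫ z in Metric.ball (0 : ℂ) r, ‖z‖ ^ (2 * n) * (1 - ‖z‖ ^ 2) ^ (-β) =
      Real.pi * betaInt β n (r ^ 2) := by
  rw [setIntegral_ball_norm (fun s => s ^ (2 * n) * (1 - s ^ 2) ^ (-β)) hr]
  have h := intervalIntegral.integral_comp_mul_deriv' (a := 0) (b := r) (f := fun s => s ^ 2)
    (f' := fun s => 2 * s) (g := fun t => t ^ n * (1 - t) ^ (-β))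
    (fun x _ => by simpa using hasDerivAt_pow 2 x) (by fun_prop) ?_
  · rw [betaInt, show (0 : ℝ) = 0 ^ 2 by norm_num, ← h, zero_pow two_ne_zero,
      ← intervalIntegral.integral_const_mul, ← intervalIntegral.integral_const_mul]
    refine intervalIntegral.integral_congr fun s _ => ?_
    simp only [Function.comp_apply, pow_mul]
    ring
  · refine (continuousOn_betaIntegrand β n).mono ?_
    rintro _ ⟨s, hs, rfl⟩
    rw [uIcc_of_le hr] at hs
    exact pow_lt_one₀ hs.1 (hs.2.trans_lt hr1) two_ne_zero

theorem continuousOn_radialWeight (α : ℝ) {r : ℝ} (hr1 : r < 1) :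
    ContinuousOn (fun z : ℂ => (1 - ‖z‖ ^ 2) ^ α) (Metric.closedBall 0 r) := by
  refine ContinuousOn.rpow_const (by fun_prop) fun z hz => Or.inl ?_
  have h1 : ‖z‖ < 1 := (mem_closedBall_zero_iff.1 hz).trans_lt hr1
  have : ‖z‖ ^ 2 < 1 := pow_lt_one₀ (norm_nonneg z) h1 two_ne_zero
  linarith

theorem integrableOn_ball_mul_radialWeight {𝕜 : Type*} [RCLike 𝕜] (α : ℝ) {r : ℝ} (hr1 : r < 1)
    {g : ℂ → 𝕜} (hg : Continuous g) :
    IntegrableOn (fun z : ℂ => g z * ((((1 - ‖z‖ ^ 2) ^ α : ℝ)) : 𝕜)) (Metric.ball 0 r) := by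
  have h : ContinuousOn (fun z : ℂ => g z * ((((1 - ‖z‖ ^ 2) ^ α : ℝ)) : 𝕜))
      (Metric.closedBall 0 r) :=
    hg.continuousOn.mul (RCLike.continuous_ofReal.comp_continuousOn
      (continuousOn_radialWeight α hr1))
  exact (h.integrableOn_compact (isCompact_closedBall 0 r)).mono_set Metric.ball_subset_closedBall

/-- Distinct monomials are orthogonal for a radial weight: a rotation by `π / (m - n)` changes the
sign of the integral. -/
theorem setIntegral_ball_orthogonal (α r : ℝ) {n m : ℕ} (hnm : n ≠ m) :
    ∫ z in Metric.ball (0 : ℂ) r,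
      z ^ n * (starRingEnd ℂ) z ^ m * (((1 - ‖z‖ ^ 2) ^ α : ℝ) : ℂ) = 0 := by
  have hsub : (n : ℝ) - m ≠ 0 := sub_ne_zero.2 (Nat.cast_injective.ne hnm)
  set θ : ℝ := Real.pi / (n - m) with hθ
  set a : Circle := Circle.exp θ with ha
  have hrot : (a : ℂ) ^ n * (starRingEnd ℂ) (a : ℂ) ^ m = -1 := by
    rw [ha, Circle.coe_exp, ← Complex.exp_conj, ← Complex.exp_nat_mul, ← Complex.exp_nat_mul,
      ← Complex.exp_add, ← Complex.exp_pi_mul_I]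
    congr 1
    have hsub' : (n : ℂ) - m ≠ 0 := sub_ne_zero.2 (Nat.cast_injective.ne hnm)
    simp only [hθ, map_mul, Complex.conj_I, Complex.conj_ofReal]
    push_cast
    field_simp
    ring
  have hmp := (rotation a).measurePreserving
  have hpre : rotation a ⁻¹' Metric.ball (0 : ℂ) r = Metric.ball 0 r := by
    ext z
    rw [mem_preimage, mem_ball_zero_iff, mem_ball_zero_iff, LinearIsometryEquiv.norm_map]
  have h := hmp.setIntegral_preimage_emb (rotation a).toHomeomorph.measurableEmbedding
    (fun z : ℂ => z ^ n * (starRingEnd ℂ) z ^ m * (((1 - ‖z‖ ^ 2) ^ α : ℝ) : ℂ)) (Metric.ball 0 r)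
  rw [hpre] at h
  have h2 : ∀ z : ℂ, (rotation a z) ^ n * (starRingEnd ℂ) (rotation a z) ^ m *
      (((1 - ‖rotation a z‖ ^ 2) ^ α : ℝ) : ℂ) =
      -(z ^ n * (starRingEnd ℂ) z ^ m * (((1 - ‖z‖ ^ 2) ^ α : ℝ) : ℂ)) := by
    intro z
    rw [LinearIsometryEquiv.norm_map, rotation_apply, map_mul, mul_pow, mul_pow]
    linear_combination (z ^ n * (starRingEnd ℂ) z ^ m * (((1 - ‖z‖ ^ 2) ^ α : ℝ) : ℂ)) * hrot
  simp_rw [h2] at h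
  rw [integral_neg] at h
  exact self_eq_neg.1 h.symm

theorem setIntegral_ball_sum_monomial (β : ℝ) {r : ℝ} (hr : 0 ≤ r) (hr1 : r < 1) (a : ℕ → ℂ)
    (N : ℕ) :
    ∫ z in Metric.ball (0 : ℂ) r,
      ‖∑ n ∈ Finset.range N, a n * z ^ n‖ ^ 2 * (1 - ‖z‖ ^ 2) ^ (-β) =
      ∑ n ∈ Finset.range N, ‖a n‖ ^ 2 * (Real.pi * betaInt β n (r ^ 2)) := by
  apply Complex.ofReal_injective
  rw [← integral_complex_ofReal]
  have hexp : ∀ z : ℂ, ((‖∑ n ∈ Finset.range N, a n * z ^ n‖ ^ 2 * (1 - ‖z‖ ^ 2) ^ (-β) : ℝ) : ℂ) =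
      ∑ n ∈ Finset.range N, ∑ m ∈ Finset.range N, a n * (starRingEnd ℂ) (a m) *
        (z ^ n * (starRingEnd ℂ) z ^ m * (((1 - ‖z‖ ^ 2) ^ (-β) : ℝ) : ℂ)) := by
    intro z
    rw [Complex.ofReal_mul, Complex.ofReal_pow, ← Complex.mul_conj', map_sum,
      Finset.sum_mul_sum, Finset.sum_mul]
    refine Finset.sum_congr rfl fun n _ => ?_
    rw [Finset.sum_mul]
    refine Finset.sum_congr rfl fun m _ => ?_
    simp only [map_mul, map_pow]
    ring
  have hint : ∀ n m : ℕ, IntegrableOn (fun z : ℂ => a n * (starRingEnd ℂ) (a m) *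
      (z ^ n * (starRingEnd ℂ) z ^ m * (((1 - ‖z‖ ^ 2) ^ (-β) : ℝ) : ℂ))) (Metric.ball 0 r) :=
    fun n m => (integrableOn_ball_mul_radialWeight (𝕜 := ℂ) (-β) hr1
      (g := fun z => z ^ n * (starRingEnd ℂ) z ^ m) (by fun_prop)).const_mul _
  simp_rw [hexp]
  rw [integral_finsetSum _ fun n _ => integrable_finsetSum _ fun m _ => hint n m,
    Complex.ofReal_sum]
  refine Finset.sum_congr rfl fun n hn => ?_
  rw [integral_finsetSum _ fun m _ => hint n m, Finset.sum_eq_single_of_mem n hn]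
  · rw [integral_const_mul, ← setIntegral_ball_monomial β n hr hr1, Complex.ofReal_mul,
      ← integral_complex_ofReal, Complex.mul_conj', Complex.ofReal_pow]
    congr 2
    ext z
    rw [← mul_pow, Complex.mul_conj', pow_mul]
    push_cast
    rfl
  · intro m _ hmn
    rw [integral_const_mul, setIntegral_ball_orthogonal (-β) r hmn.symm, mul_zero]

/-- Parseval's identity: the area mean of `f` is the sum of the area means of the monomials of its
Taylor series, weighted with the squared moduli of the coefficients. -/
theorem tendsto_sum_monomialMean (β : ℝ) {f : ℂ → ℂ} {a : ℕ → ℂ}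
    (hf : ∀ z ∈ Metric.ball (0 : ℂ) 1, HasSum (fun n => a n * z ^ n) (f z))
    {r : ℝ} (hr : 0 < r) (hr1 : r < 1) :
    Tendsto (fun N => ∑ n ∈ Finset.range N, ‖a n‖ ^ 2 * monomialMean β n r) atTop
      (𝓝 (areaMean 2 (-β) f r)) := by
  have hsum : Summable fun n => ‖a n‖ * r ^ n := by
    have h := (hf (r : ℂ) (by simpa [abs_of_pos hr] using hr1)).summable.norm
    refine h.congr fun n => ?_
    rw [norm_mul, norm_pow, Complex.norm_real, Real.norm_of_nonneg hr.le]
  set C := ∑' n, ‖a n‖ * r ^ n with hC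
  have hball : Metric.ball (0 : ℂ) r ⊆ Metric.ball 0 1 := Metric.ball_subset_ball hr1.le
  have hlim : Tendsto (fun N => ∫ z in Metric.ball (0 : ℂ) r,
      ‖∑ n ∈ Finset.range N, a n * z ^ n‖ ^ 2 * (1 - ‖z‖ ^ 2) ^ (-β)) atTop
      (𝓝 (∫ z in Metric.ball (0 : ℂ) r, ‖f z‖ ^ (2 : ℝ) * (1 - ‖z‖ ^ 2) ^ (-β))) := by
    refine tendsto_integral_of_dominated_convergence
      (fun z => C ^ 2 * (1 - ‖z‖ ^ 2) ^ (-β)) (fun N => ?_) ?_ (fun N => ?_) ?_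
    · exact (integrableOn_ball_mul_radialWeight (𝕜 := ℝ) (-β) hr1
        (g := fun z => ‖∑ n ∈ Finset.range N, a n * z ^ n‖ ^ 2)
        (by fun_prop)).aestronglyMeasurable
    · exact integrableOn_ball_mul_radialWeight (𝕜 := ℝ) (-β) hr1 continuous_const
    · refine (ae_restrict_iff' measurableSet_ball).2 (.of_forall fun z hz => ?_)
      have hz' : ‖z‖ < r := mem_ball_zero_iff.1 hz
      have hw : 0 ≤ (1 - ‖z‖ ^ 2) ^ (-β) := Real.rpow_nonneg (by
        nlinarith [norm_nonneg z]) _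
      rw [norm_mul, Real.norm_of_nonneg hw, norm_pow, norm_norm]
      refine mul_le_mul_of_nonneg_right (pow_le_pow_left₀ (norm_nonneg _) ?_ 2) hw
      calc ‖∑ n ∈ Finset.range N, a n * z ^ n‖ ≤ ∑ n ∈ Finset.range N, ‖a n‖ * r ^ n := by
            refine norm_sum_le_of_le _ fun n _ => ?_
            rw [norm_mul, norm_pow]
            gcongr
        _ ≤ C := hsum.sum_le_tsum _ fun n _ => by positivity
    · refine (ae_restrict_iff' measurableSet_ball).2 (.of_forall fun z hz => ?_)
      simp_rw [Real.rpow_two]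
      exact ((hf z (hball hz)).tendsto_sum_nat.norm.pow 2).mul_const _
  have hden : ∫ z in Metric.ball (0 : ℂ) r, (1 - ‖z‖ ^ 2) ^ (-β) =
      Real.pi * betaInt β 0 (r ^ 2) := by
    rw [← setIntegral_ball_monomial β 0 hr.le hr1]
    simp
  rw [areaMean, hden]
  refine (hlim.div_const (Real.pi * betaInt β 0 (r ^ 2))).congr fun N => ?_
  rw [setIntegral_ball_sum_monomial β hr.le hr1, Finset.sum_div]
  refine Finset.sum_congr rfl fun n _ => ?_
  have hF : betaInt β 0 (r ^ 2) ≠ 0 :=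
    (betaInt_pos β 0 ⟨by positivity, pow_lt_one₀ hr.le hr1 two_ne_zero⟩).ne'
  rw [monomialMean]
  field_simp

theorem hasSum_taylor_of_analyticOnNhd {f : ℂ → ℂ}
    (hf : AnalyticOnNhd ℂ f (Metric.ball (0 : ℂ) 1)) {z : ℂ} (hz : z ∈ Metric.ball (0 : ℂ) 1) :
    HasSum (fun n : ℕ => (n.factorial : ℂ)⁻¹ * iteratedDeriv n f 0 * z ^ n) (f z) := by
  convert! Complex.hasSum_taylorSeries_on_ball hf.differentiableOn hz using 2 with n
  rw [sub_zero, smul_eq_mul, smul_eq_mul]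
  ring

theorem areaMean_id (β : ℝ) {r : ℝ} (hr : 0 < r) (hr1 : r < 1) :
    areaMean 2 (-β) (fun z => z) r = monomialMean β 1 r := by
  have hs : ∀ z ∈ Metric.ball (0 : ℂ) 1,
      HasSum (fun n => (if n = 1 then (1 : ℂ) else 0) * z ^ n) z := by
    intro z _
    have h := hasSum_ite_eq (1 : ℕ) z
    refine h.congr_fun fun n => ?_
    split_ifs with h1 <;> simp [h1]
  refine tendsto_nhds_unique (tendsto_sum_monomialMean β hs hr hr1) ?_
  refine tendsto_const_nhds.congr' ((eventually_ge_atTop 2).mono fun N hN => ?_)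
  beta_reduce
  rw [Finset.sum_eq_single_of_mem 1 (Finset.mem_range.2 (by omega))]
  · simp
  · intro n _ hn
    simp [hn]

/-! ### Logarithmic convexity in general -/

/-- Hölder's inequality for weighted geometric means. -/
theorem sum_mul_rpow_mul_rpow_le {ι : Type*} (s : Finset ι) (c x y : ι → ℝ)
    (hc : ∀ i ∈ s, 0 ≤ c i) (hx : ∀ i ∈ s, 0 ≤ x i) (hy : ∀ i ∈ s, 0 ≤ y i) {p q : ℝ} (hp : 0 < p)
    (hq : 0 < q) (hpq : p + q = 1) :
    ∑ i ∈ s, c i * (x i ^ p * y i ^ q) ≤ (∑ i ∈ s, c i * x i) ^ p * (∑ i ∈ s, c i * y i) ^ q := by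
  have hconj : Real.HolderConjugate p⁻¹ q⁻¹ :=
    Real.holderConjugate_iff.2 ⟨(one_lt_inv₀ hp).2 (by linarith), by simpa using hpq⟩
  have h := Real.inner_le_Lp_mul_Lq_of_nonneg s hconj
    (f := fun i => (c i * x i) ^ p) (g := fun i => (c i * y i) ^ q)
    (fun i hi => Real.rpow_nonneg (mul_nonneg (hc i hi) (hx i hi)) _)
    (fun i hi => Real.rpow_nonneg (mul_nonneg (hc i hi) (hy i hi)) _)
  simp only [one_div, inv_inv] at h
  have e1 : ∑ i ∈ s, ((c i * x i) ^ p) ^ p⁻¹ = ∑ i ∈ s, c i * x i :=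
    Finset.sum_congr rfl fun i hi => Real.rpow_rpow_inv (mul_nonneg (hc i hi) (hx i hi)) hp.ne'
  have e2 : ∑ i ∈ s, ((c i * y i) ^ q) ^ q⁻¹ = ∑ i ∈ s, c i * y i :=
    Finset.sum_congr rfl fun i hi => Real.rpow_rpow_inv (mul_nonneg (hc i hi) (hy i hi)) hq.ne'
  rw [e1, e2] at h
  refine le_trans (Finset.sum_le_sum fun i hi => le_of_eq ?_) h
  rw [Real.mul_rpow (hc i hi) (hx i hi), Real.mul_rpow (hc i hi) (hy i hi)]
  have : c i = c i ^ p * c i ^ q := by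
    rw [← Real.rpow_add_of_nonneg (hc i hi) hp.le hq.le, hpq, Real.rpow_one]
  nth_rewrite 1 [this]
  ring

theorem convexInLog_log_areaMean {β : ℝ} (hβ : 0 ≤ β) (hβ3 : β ≤ 3) {f : ℂ → ℂ}
    (hf : AnalyticOnNhd ℂ f (Metric.ball (0 : ℂ) 1)) :
    ConvexInLog fun r => Real.log (areaMean 2 (-β) f r) := by
  set a : ℕ → ℂ := fun n => (n.factorial : ℂ)⁻¹ * iteratedDeriv n f 0 with ha
  have hlim : ∀ t < (0 : ℝ), Tendsto
      (fun N => ∑ n ∈ Finset.range N, ‖a n‖ ^ 2 * monomialMean β n (Real.exp t)) atTop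
      (𝓝 (areaMean 2 (-β) f (Real.exp t))) := fun t ht =>
    tendsto_sum_monomialMean β (fun z hz => hasSum_taylor_of_analyticOnNhd hf hz)
      (Real.exp_pos t) (Real.exp_lt_one_iff.2 ht)
  have hnn : ∀ t < (0 : ℝ), ∀ n, 0 ≤ ‖a n‖ ^ 2 * monomialMean β n (Real.exp t) := fun t ht n =>
    mul_nonneg (sq_nonneg _) (monomialMean_pos β n ht).le
  -- If `f` vanishes on the disk, the mean is `0` and its logarithm is the constant `Real.log 0 = 0`.
  by_cases hzero : ∀ n, a n = 0
  · have h0 : ∀ t < (0 : ℝ), areaMean 2 (-β) f (Real.exp t) = 0 := fun t ht =>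
      tendsto_nhds_unique (hlim t ht) (by simp [hzero])
    refine ConvexOn.congr (convexOn_const 0 (convex_Iio 0)) fun t ht => ?_
    simp [h0 t ht]
  · push Not at hzero
    obtain ⟨k, hk⟩ := hzero
    have hpos : ∀ t < (0 : ℝ), 0 < areaMean 2 (-β) f (Real.exp t) := by
      intro t ht
      have h1 : 0 < ‖a k‖ ^ 2 * monomialMean β k (Real.exp t) :=
        mul_pos (pow_pos (norm_pos_iff.2 hk) 2) (monomialMean_pos β k ht)
      refine h1.trans_le (ge_of_tendsto (hlim t ht) ((eventually_gt_atTop k).mono fun N hN => ?_))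
      exact Finset.single_le_sum (f := fun n => ‖a n‖ ^ 2 * monomialMean β n (Real.exp t))
        (fun n _ => hnn t ht n) (Finset.mem_range.2 hN)
    refine convexOn_iff_forall_pos.2 ⟨convex_Iio 0, fun u hu v hv p q hp hq hpq => ?_⟩
    have huv : p • u + q • v < 0 := convex_Iio (0 : ℝ) hu hv hp.le hq.le hpq
    have hmono : ∀ n, monomialMean β n (Real.exp (p • u + q • v)) ≤
        monomialMean β n (Real.exp u) ^ p * monomialMean β n (Real.exp v) ^ q := by
      intro n
      have h1 := monomialMean_pos β n hu
      have h2 := monomialMean_pos β n hv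
      have h3 := (convexInLog_log_monomialMean hβ hβ3 n).2 hu hv hp.le hq.le hpq
      rw [← Real.log_le_log_iff (monomialMean_pos β n huv) (by positivity),
        Real.log_mul (by positivity) (by positivity), Real.log_rpow h1, Real.log_rpow h2]
      exact h3
    have hle : areaMean 2 (-β) f (Real.exp (p • u + q • v)) ≤
        areaMean 2 (-β) f (Real.exp u) ^ p * areaMean 2 (-β) f (Real.exp v) ^ q := by
      refine le_of_tendsto_of_tendsto' (hlim _ huv)
        (((hlim u hu).rpow_const (Or.inr hp.le)).mul ((hlim v hv).rpow_const (Or.inr hq.le)))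
        fun N => ?_
      refine le_trans (Finset.sum_le_sum fun n _ =>
        mul_le_mul_of_nonneg_left (hmono n) (sq_nonneg _)) ?_
      exact sum_mul_rpow_mul_rpow_le _ _ _ _ (fun _ _ => sq_nonneg _)
        (fun n _ => (monomialMean_pos β n hu).le) (fun n _ => (monomialMean_pos β n hv).le) hp hq hpq
    have h1 := hpos u hu
    have h2 := hpos v hv
    have h4 := Real.log_le_log (hpos _ huv) hle
    rwa [Real.log_mul (by positivity) (by positivity), Real.log_rpow h1, Real.log_rpow h2] at h4

/-! ### Sharpness of the range -/

theorem pos_of_hasDerivAt_pos {g g' : ℝ → ℝ} (hc : ContinuousOn g (Ico 0 1)) (h0 : g 0 = 0)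
    (hd : ∀ x ∈ Ioo (0 : ℝ) 1, HasDerivAt g (g' x) x) (hg' : ∀ x ∈ Ioo (0 : ℝ) 1, 0 < g' x)
    {x : ℝ} (hx : x ∈ Ioo (0 : ℝ) 1) : 0 < g x := by
  have hmono : StrictMonoOn g (Ico 0 1) := by
    refine strictMonoOn_of_hasDerivWithinAt_pos (convex_Ico 0 1) hc (f' := g') ?_ ?_
    · intro y hy
      rw [interior_Ico] at hy
      exact (hd y hy).hasDerivWithinAt
    · intro y hy
      rw [interior_Ico] at hy
      exact hg' y hy
  have := hmono (left_mem_Ico.2 one_pos) (Ioo_subset_Ico_self hx) hx.1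
  rwa [h0] at this

/-- A decreasing weight pushes the mean to the left of the midpoint. -/
theorem relMean_lt_half {β : ℝ} (hβ : β < 0) {x : ℝ} (hx : x ∈ Ioo (0 : ℝ) 1) :
    relMean β x < 1 / 2 := by
  have hslope : ∀ y ∈ Ioo (0 : ℝ) 1, 0 < betaInt β 0 y - y ^ (0 + 1) * (1 - y) ^ (-β) := by
    intro y hy
    refine pos_of_hasDerivAt_pos
      (g := fun x => betaInt β 0 x - x ^ (0 + 1) * (1 - x) ^ (-β))
      (g' := fun x => -β * x / (1 - x) * (1 - x) ^ (-β))
      ((continuousOn_betaInt β 0).sub (continuousOn_weight β 0)) (by simp)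
      (fun y hy => ?_) (fun y hy => ?_) hy
    · refine ((hasDerivAt_betaInt β 0 hy.2).sub (hasDerivAt_weight β 0 hy)).congr_deriv ?_
      have h1 : 1 - y ≠ 0 := (sub_pos.2 hy.2).ne'
      have h2 := hy.1.ne'
      simp only [weightSlope]
      push_cast
      field_simp
      ring
    · have h1 : 0 < 1 - y := sub_pos.2 hy.2
      exact mul_pos (div_pos (mul_pos (neg_pos.2 hβ) hy.1) h1) (Real.rpow_pos_of_pos h1 _)
  have key : 0 < x * betaInt β 0 x / 2 - betaInt β 1 x := by
    refine pos_of_hasDerivAt_pos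
      (g := fun x => x * betaInt β 0 x / 2 - betaInt β 1 x)
      (g' := fun x => (betaInt β 0 x - x ^ (0 + 1) * (1 - x) ^ (-β)) / 2)
      (((continuousOn_id.mul (continuousOn_betaInt β 0)).div_const 2).sub (continuousOn_betaInt β 1))
      (by simp) (fun y hy => ?_) (fun y hy => half_pos (hslope y hy)) hx
    refine ((((hasDerivAt_id y).mul (hasDerivAt_betaInt β 0 hy.2)).div_const 2).sub
      (hasDerivAt_betaInt β 1 hy.2)).congr_deriv ?_
    simp only [id]
    ring
  rw [relMean, div_lt_iff₀ (mul_pos hx.1 (betaInt_pos β 0 hx))]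
  linarith

theorem le_relMean {β : ℝ} (hβ : β ≤ 0) {x : ℝ} (hx : x ∈ Ioo (0 : ℝ) 1) :
    (1 - x) ^ (-β) / 2 ≤ relMean β x := by
  have hF0 : betaInt β 0 x ≤ x := by
    have h := intervalIntegral.integral_mono_on hx.1.le
      (intervalIntegrable_betaIntegrand β 0 one_pos hx.2)
      (intervalIntegrable_const (c := (1 : ℝ)) (μ := volume)) fun t ht => by
        rw [pow_zero, one_mul]
        exact Real.rpow_le_one (by linarith [ht.2, hx.2]) (by linarith [ht.1]) (by linarith)
    simpa [betaInt] using h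
  have hF1 : x ^ 2 / 2 * (1 - x) ^ (-β) ≤ betaInt β 1 x := by
    have h := intervalIntegral.integral_mono_on (f := fun t => t * (1 - x) ^ (-β)) hx.1.le
      ((continuous_id.mul continuous_const).intervalIntegrable 0 x)
      (intervalIntegrable_betaIntegrand β 1 one_pos hx.2) fun t ht => by
        rw [pow_one]
        exact mul_le_mul_of_nonneg_left (Real.rpow_le_rpow (by linarith [hx.2])
          (by linarith [ht.2]) (by linarith)) ht.1
    rw [intervalIntegral.integral_mul_const, integral_id] at h
    simpa [betaInt] using h
  have hw : 0 ≤ (1 - x) ^ (-β) := Real.rpow_nonneg (by linarith [hx.2]) _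
  rw [relMean, le_div_iff₀ (mul_pos hx.1 (betaInt_pos β 0 hx))]
  calc (1 - x) ^ (-β) / 2 * (x * betaInt β 0 x) ≤ (1 - x) ^ (-β) / 2 * (x * x) := by
        have := hx.1.le
        gcongr
    _ = x ^ 2 / 2 * (1 - x) ^ (-β) := by ring
    _ ≤ _ := hF1

theorem log_monomialMean_one (β : ℝ) {t : ℝ} (ht : t < 0) :
    Real.log (monomialMean β 1 (Real.exp t)) = 2 * t + Real.log (relMean β (Real.exp t ^ 2)) := by
  have hx := exp_sq_mem_Ioo ht
  have h : monomialMean β 1 (Real.exp t) = Real.exp t ^ 2 * relMean β (Real.exp t ^ 2) := by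
    have h1 := hx.1.ne'
    have h2 := (betaInt_pos β 0 hx).ne'
    rw [monomialMean, relMean]
    field_simp
  rw [h, Real.log_mul hx.1.ne' (relMean_pos β hx).ne', Real.log_pow, Real.log_exp]
  push_cast
  ring

/-- For `β < 0` convexity fails near `r = 0`: `log (relMean β (exp t ^ 2))` lies below its limit
`log (1 / 2)` at `-∞`, which a convex function cannot do. -/
theorem not_convexInLog_of_neg {β : ℝ} (hβ : β < 0) :
    ¬ ConvexInLog fun r => Real.log (monomialMean β 1 r) := by
  intro hconv
  set h : ℝ → ℝ := fun t => Real.log (relMean β (Real.exp t ^ 2)) with hh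
  have hlt : ∀ t < 0, h t < Real.log (1 / 2) := fun t ht =>
    Real.log_lt_log (relMean_pos β (exp_sq_mem_Ioo ht)) (relMean_lt_half hβ (exp_sq_mem_Ioo ht))
  -- `t` is the midpoint of `2 t + 1` and `-1`
  have hmid : ∀ t < (-1 : ℝ), h t ≤ (Real.log (1 / 2) + h (-1)) / 2 := by
    intro t ht
    have hs : 2 * t + 1 < 0 := by linarith
    have ht0 : t < 0 := by linarith
    have hc := hconv.2 (mem_Iio.2 hs) (mem_Iio.2 (by norm_num : (-1 : ℝ) < 0))
      (by norm_num : (0 : ℝ) ≤ 1 / 2) (by norm_num : (0 : ℝ) ≤ 1 / 2) (by norm_num)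
    have he : (1 / 2 : ℝ) • (2 * t + 1) + (1 / 2 : ℝ) • (-1 : ℝ) = t := by
      simp only [smul_eq_mul]
      ring
    beta_reduce at hc
    rw [he, log_monomialMean_one β ht0, log_monomialMean_one β hs,
      log_monomialMean_one β (by norm_num : (-1 : ℝ) < 0), smul_eq_mul, smul_eq_mul] at hc
    have := hlt _ hs
    simp only [hh] at this ⊢
    linarith
  have hlim : Tendsto (fun t : ℝ => Real.log ((1 - Real.exp t ^ 2) ^ (-β) / 2)) atBot
      (𝓝 (Real.log (1 / 2))) := by
    have h1 : Tendsto (fun t : ℝ => 1 - Real.exp t ^ 2) atBot (𝓝 (1 - 0 ^ 2)) :=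
      (Real.tendsto_exp_atBot.pow 2).const_sub 1
    have h2 := (h1.rpow_const (p := -β) (Or.inl (by norm_num))).div_const 2
    simp only [zero_pow two_ne_zero, sub_zero, Real.one_rpow] at h2
    exact h2.log (by norm_num)
  have hle : Real.log (1 / 2) ≤ (Real.log (1 / 2) + h (-1)) / 2 := by
    refine le_of_tendsto hlim ((eventually_lt_atBot (-1)).mono fun t ht => ?_)
    have ht0 : t < 0 := by linarith
    have hx := exp_sq_mem_Ioo ht0
    refine le_trans (Real.log_le_log ?_ (le_relMean hβ.le hx)) (hmid t ht)
    exact half_pos (Real.rpow_pos_of_pos (by linarith [hx.2]) _)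
  linarith [hlt (-1) (by norm_num)]

theorem betaInt_zero_eq {β : ℝ} (hβ : β ≠ 1) {x : ℝ} (hx : x < 1) :
    betaInt β 0 x = ((1 - x) ^ (1 - β) - 1) / (β - 1) := by
  have hβ' : β - 1 ≠ 0 := sub_ne_zero.2 hβ
  rw [betaInt, intervalIntegral.integral_eq_sub_of_hasDerivAt
    (f := fun t => (1 - t) ^ (1 - β) / (β - 1)) (fun t ht => ?_)
    (intervalIntegrable_betaIntegrand β 0 one_pos hx)]
  · simp only [sub_zero, Real.one_rpow]
    ring
  · have h1 : 1 - t ≠ 0 := (sub_pos.2 (ht.2.trans_lt (max_lt one_pos hx))).ne'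
    refine ((((hasDerivAt_id t).const_sub 1).rpow_const (p := 1 - β) (Or.inl h1)).div_const
      (β - 1)).congr_deriv ?_
    simp only [id, pow_zero, one_mul, show 1 - β - 1 = -β by ring]
    field_simp
    ring

/-- The logarithmic derivative of `monomialMean β 1` in closed form, written so that it extends
continuously to `x = 1` when `β > 3`. -/
theorem betaSlope_one_sub_zero {β : ℝ} (hβ : 3 < β) {x : ℝ} (hx : x ∈ Ioo (0 : ℝ) 1) :
    0 < (β - 1) * x - 1 + (1 - x) ^ 2 * (1 - x) ^ (β - 3) ∧
    0 < 1 - (1 - x) ^ 2 * (1 - x) ^ (β - 3) ∧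
    betaSlope β 1 x - betaSlope β 0 x =
      (β - 1) * x * (1 - (1 - x) * (1 - x) ^ (β - 3) * (1 + (β - 2) * x)) /
      ((1 - (1 - x) ^ 2 * (1 - x) ^ (β - 3)) *
        ((β - 1) * x - 1 + (1 - x) ^ 2 * (1 - x) ^ (β - 3))) := by
  have hy : 0 < 1 - x := sub_pos.2 hx.2
  set S := (1 - x) ^ (β - 3) with hS
  have hSpos : 0 < S := Real.rpow_pos_of_pos hy _
  have hw : (1 - x) ^ (-β) = ((1 - x) ^ 3 * S)⁻¹ := by
    rw [hS, Real.rpow_neg hy.le, ← Real.rpow_natCast, ← Real.rpow_add hy]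
    congr 2
    push_cast
    ring
  have hZ : (1 - x) ^ (1 - β) = ((1 - x) ^ 2 * S)⁻¹ := by
    rw [show 1 - β = 1 + -β by ring, Real.rpow_add hy, Real.rpow_one, hw]
    field_simp
  have h1 : β - 1 ≠ 0 := by linarith
  have h2 : β - 2 ≠ 0 := by linarith
  have hF0 : betaInt β 0 x = (1 - (1 - x) ^ 2 * S) / ((β - 1) * ((1 - x) ^ 2 * S)) := by
    rw [betaInt_zero_eq (by linarith) hx.2, hZ]
    field_simp
  have hF1 : betaInt β 1 x = ((β - 1) * x - 1 + (1 - x) ^ 2 * S) /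
      ((β - 1) * (β - 2) * ((1 - x) ^ 2 * S)) := by
    have h := betaInt_zero_add_betaInt_one β hx
    rw [hF0, hw] at h
    have h' : betaInt β 1 x = (x * (1 - x) * ((1 - x) ^ 3 * S)⁻¹ -
        (1 - (1 - x) ^ 2 * S) / ((β - 1) * ((1 - x) ^ 2 * S))) / (β - 2) := by
      rw [eq_div_iff h2]
      linarith
    rw [h']
    field_simp
    ring
  have hp0 := betaInt_pos β 0 hx
  have hp1 := betaInt_pos β 1 hx
  rw [hF0] at hp0
  rw [hF1] at hp1
  have hb1 : 0 < β - 1 := by linarith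
  have hb2 : 0 < β - 2 := by linarith
  have hE := (div_pos_iff_of_pos_right (by positivity)).1 hp1
  have hV := (div_pos_iff_of_pos_right (by positivity)).1 hp0
  refine ⟨hE, hV, ?_⟩
  rw [betaSlope, betaSlope, hF0, hF1, hw]
  have hE' := hE.ne'
  have hV' := hV.ne'
  generalize hEdef : (β - 1) * x - 1 + (1 - x) ^ 2 * S = E at *
  generalize hVdef : 1 - (1 - x) ^ 2 * S = V at *
  have hy' := hy.ne'
  field_simp
  rw [← hEdef, ← hVdef]
  ring

/-- For `β > 3` convexity fails near `r = 1`: the logarithmic derivative of `monomialMean β 1` exceeds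
its limit `(β - 1) / (β - 2)` at `r = 1`, so it is not monotone. -/
theorem not_convexInLog_of_three_lt {β : ℝ} (hβ : 3 < β) :
    ¬ ConvexInLog fun r => Real.log (monomialMean β 1 r) := by
  intro hconv
  set D : ℝ → ℝ := fun x => betaSlope β 1 x - betaSlope β 0 x with hD
  have hmono : ∀ x ∈ Ioo (0 : ℝ) 1, ∀ y ∈ Ioo (0 : ℝ) 1, x ≤ y → D x ≤ D y := by
    intro x hx y hy hxy
    have hd := hconv.monotoneOn_deriv fun t ht =>
      (hasDerivAt_log_monomialMean β 1 ht).differentiableAt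
    have hlog : ∀ z ∈ Ioo (0 : ℝ) 1, Real.log z / 2 < 0 ∧ Real.exp (Real.log z / 2) ^ 2 = z := by
      intro z hz
      refine ⟨by linarith [Real.log_neg hz.1 hz.2], ?_⟩
      rw [← Real.exp_nat_mul]
      push_cast
      rw [mul_div_cancel₀ _ two_ne_zero, Real.exp_log hz.1]
    have h := hd (hlog x hx).1 (hlog y hy).1
      (div_le_div_of_nonneg_right (Real.log_le_log hx.1 hxy) two_pos.le)
    rw [(hasDerivAt_log_monomialMean β 1 (hlog x hx).1).deriv,
      (hasDerivAt_log_monomialMean β 1 (hlog y hy).1).deriv, (hlog x hx).2, (hlog y hy).2] at h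
    simp only [hD]
    linarith
  have hb1 : 0 < β - 1 := by linarith
  have hb2 : 0 < β - 2 := by linarith
  have hIoo : ∀ᶠ x in 𝓝[<] (1 : ℝ), x ∈ Ioo (0 : ℝ) 1 := Ioo_mem_nhdsLT one_pos
  have hScont : ContinuousAt (fun x : ℝ => (1 - x) ^ (β - 3)) 1 :=
    ContinuousAt.rpow_const (by fun_prop) (Or.inr (by linarith))
  have hS1 : (1 - 1 : ℝ) ^ (β - 3) = 0 := by
    rw [sub_self]
    exact Real.zero_rpow (by linarith)
  have hlim : Tendsto D (𝓝[<] 1) (𝓝 ((β - 1) / (β - 2))) := by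
    have hcont : ContinuousAt (fun x : ℝ =>
        (β - 1) * x * (1 - (1 - x) * (1 - x) ^ (β - 3) * (1 + (β - 2) * x)) /
        ((1 - (1 - x) ^ 2 * (1 - x) ^ (β - 3)) *
          ((β - 1) * x - 1 + (1 - x) ^ 2 * (1 - x) ^ (β - 3)))) 1 := by
      refine ContinuousAt.div (by fun_prop) (by fun_prop) ?_
      rw [hS1]
      norm_num
      linarith
    have h := hcont.tendsto
    rw [hS1] at h
    have hval : (β - 1) * 1 * (1 - (1 - 1) * 0 * (1 + (β - 2) * 1)) /
        ((1 - (1 - 1) ^ 2 * 0) * ((β - 1) * 1 - 1 + (1 - 1) ^ 2 * 0)) = (β - 1) / (β - 2) := by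
      congr 1 <;> ring
    rw [hval] at h
    refine (h.mono_left nhdsWithin_le_nhds).congr' (hIoo.mono fun x hx => ?_)
    exact (betaSlope_one_sub_zero hβ hx).2.2.symm
  have hsmall : ∀ᶠ x in 𝓝[<] (1 : ℝ),
      0 < 1 - (1 - x) * (1 - x) ^ (β - 3) - (β - 2) * (β - 1) * (1 - x) ^ (β - 3) := by
    have hcont : ContinuousAt (fun x : ℝ => 1 - (1 - x) * (1 - x) ^ (β - 3) -
        (β - 2) * (β - 1) * (1 - x) ^ (β - 3)) 1 := by fun_prop
    refine (hcont.tendsto.mono_left nhdsWithin_le_nhds).eventually_const_lt ?_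
    rw [hS1]
    norm_num
  obtain ⟨x, hx, hxS⟩ := (hIoo.and hsmall).exists
  have hgt : (β - 1) / (β - 2) < D x := by
    obtain ⟨hE, hV, hDx⟩ := betaSlope_one_sub_zero hβ hx
    have hy : 0 < 1 - x := sub_pos.2 hx.2
    have hS : 0 < (1 - x) ^ (β - 3) := Real.rpow_pos_of_pos hy _
    simp only [hD, hDx]
    generalize (1 - x) ^ (β - 3) = S at *
    rw [div_lt_div_iff₀ hb2 (mul_pos hV hE)]
    have h3 : 0 < (1 - x) * (1 - (1 - x) * S - (β - 2) * (β - 1) * S) := mul_pos hy hxS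
    -- the excess over the limit is dominated by `1 - x`, because `S = (1 - x) ^ (β - 3)` tends to `0`
    have h4 : 0 ≤ (1 - x) ^ 2 * S * ((β - 1) * x - 1 + (1 - x) ^ 2 * S) := by positivity
    have h5 : 0 ≤ (1 - x) * S * (β - 2) * ((β - 1) - x * (1 + (β - 2) * x)) := by
      refine mul_nonneg (by positivity) ?_
      have : x * (1 + (β - 2) * x) ≤ 1 * (1 + (β - 2) * 1) := by
        have hx1 := hx.1.le
        have hx2 := hx.2.le
        gcongr
      linarith
    have h6 : 0 < (β - 2) * x * (1 - (1 - x) * S * (1 + (β - 2) * x)) -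
        (1 - (1 - x) ^ 2 * S) * ((β - 1) * x - 1 + (1 - x) ^ 2 * S) := by
      have e : (β - 2) * x * (1 - (1 - x) * S * (1 + (β - 2) * x)) -
        (1 - (1 - x) ^ 2 * S) * ((β - 1) * x - 1 + (1 - x) ^ 2 * S) =
        (1 - x) * (1 - (1 - x) * S - (β - 2) * (β - 1) * S) +
        (1 - x) ^ 2 * S * ((β - 1) * x - 1 + (1 - x) ^ 2 * S) +
        (1 - x) * S * (β - 2) * ((β - 1) - x * (1 + (β - 2) * x)) := by ring
      rw [e]
      linarith
    nlinarith [mul_pos hb1 h6]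
  refine hgt.not_ge (ge_of_tendsto hlim ?_)
  filter_upwards [hIoo, Ioo_mem_nhdsLT hx.2] with y hy hxy
  exact hmono x hx y hy hxy.1.le

end

theorem theorem8 :
    (∀ α : ℝ, -3 ≤ α → α ≤ 0 →
      ∀ f : ℂ → ℂ, AnalyticOnNhd ℂ f (Metric.ball (0 : ℂ) 1) →
        ConvexInLog (fun r => Real.log (areaMean 2 α f r))) ∧
    (∀ α : ℝ, ¬ (-3 ≤ α ∧ α ≤ 0) →
      ∃ f : ℂ → ℂ, AnalyticOnNhd ℂ f (Metric.ball (0 : ℂ) 1) ∧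
        ¬ ConvexInLog (fun r => Real.log (areaMean 2 α f r))) := by
  refine ⟨fun α h3 h0 f hf => ?_, fun α hα => ⟨fun z => z, analyticOnNhd_id, fun hconv => ?_⟩⟩
  · have h := convexInLog_log_areaMean (β := -α) (by linarith) (by linarith) hf
    rwa [neg_neg] at h
  · have hconv' : ConvexInLog fun r => Real.log (monomialMean (-α) 1 r) := by
      refine ConvexOn.congr hconv fun t ht => ?_
      have h := areaMean_id (-α) (Real.exp_pos t) (Real.exp_lt_one_iff.2 ht)
      rw [neg_neg] at h
      simp only [h]
    rw [not_and_or, not_le, not_le] at hα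
    rcases hα with hα | hα
    · exact not_convexInLog_of_three_lt (by linarith) hconv'
    · exact not_convexInLog_of_neg (by linarith) hconv'
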